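/- Let $A^2=A^2(\mathbb C,e^{-|z|^2})$ be the Segal–Bargmann space of all entire functions $u$ with $\|u\|^2=\int_{\mathbb C}|u(z)|^2e^{-|z|^2}\,d\lambda(z)<\infty$, with inner product $(u,v)=\int_{\mathbb C}u\,\overline v\,e^{-|z|^2}\,d\lambda$, where $\lambda$ is Lebesgue measure on $\mathbb C$. Let $A^2_{(1,0)}$ be the space of $(1,0)$-forms $f\,dz$ with $f\in A^2$, with norm $\|f\,dz\|=\|f\|$. Let $m\ge 0$ be an integer, let $a_0,\dots,a_m\in\mathbb C$ with $a_m\neq 0$, and put $p_m(u)=\sum_{k=0}^m a_k\,\frac{\partial^k u}{\partial z^k}$. Let $D$ be the densely defined operator $Du=p_m(u)\,dz$ from $A^2$ to $A^2_{(1,0)}$ with $\operatorname{dom}(D)=\{u\in A^2: p_m(u)\in A^2\}$, let $D^*$ be its Hilbert space adjoint, and let $\tilde\Box_{D,1}=DD^*$ with $\operatorname{dom}(\tilde\Box_{D,1})=\{f\in\operatorname{dom}(D^*): D^*f\in\operatorname{dom}(D)\}$. Then $\tilde\Box_{D,1}:\operatorname{dom}(\tilde\Box_{D,1})\to A^2_{(1,0)}$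 has a bounded inverse $\tilde N_{D,1}: A^2_{(1,0)}\to\operatorname{dom}(\tilde\Box_{D,1})$; that is, there is a bounded linear operator $\tilde N_{D,1}$ on $A^2_{(1,0)}$ with range in $\operatorname{dom}(\tilde\Box_{D,1})$ such that $\tilde\Box_{D,1}\tilde N_{D,1}\alpha=\alpha$ for all $\alpha\in A^2_{(1,0)}$ and $\tilde N_{D,1}\tilde\Box_{D,1}f=f$ for all $f\in\operatorname{dom}(\tilde\Box_{D,1})$. Moreover $(\ker D)^\perp=\operatorname{im}D^*$, and there is a constant $C>0$ such that for every $\alpha\in A^2_{(1,0)}$ the function $u_0=D^*\tilde N_{D,1}\alpha$ is the canonical solution of $Du=\alpha$: $u_0\in\operatorname{dom}(D)$, $Du_0=\alpha$, $u_0\in(\ker D)^\perp$, and $\|u_0\|\le C\|\alpha\|$. -/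

import Mathlib

open MeasureTheory Filter Topology
open scoped ComplexConjugate

noncomputable section

/-- The Segal–Bargmann space `A²(ℂ, e^{-|z|²})` as a linear subspace of the space of all
functions `ℂ → ℂ`: the entire functions `u` with `∫ |u(z)|² e^{-|z|²} dλ(z) < ∞`. -/
def segalBargmannSubmodule : Submodule ℂ (ℂ → ℂ) where
  carrier := {u | Differentiable ℂ u ∧
    Integrable (fun z : ℂ => ‖u z‖ ^ 2 * Real.exp (-‖z‖ ^ 2)) volume}
  zero_mem' := ⟨differentiable_const _, by simp⟩
  add_mem' := by
    rintro u v ⟨hu, hu'⟩ ⟨hv, hv'⟩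
    refine ⟨hu.add hv, ((hu'.add hv').const_mul 2).mono' ?_ (ae_of_all _ fun z => ?_)⟩
    · have h1 := hu.continuous
      have h2 := hv.continuous
      exact (((h1.add h2).norm.pow 2).mul (by fun_prop)).aestronglyMeasurable
    · have he := Real.exp_pos (-‖z‖ ^ 2)
      rw [Real.norm_of_nonneg (by positivity)]
      have h3 : ‖u z + v z‖ ^ 2 ≤ 2 * (‖u z‖ ^ 2 + ‖v z‖ ^ 2) := by
        have := norm_add_le (u z) (v z)
        nlinarith [norm_nonneg (u z + v z), sq_nonneg (‖u z‖ - ‖v z‖)]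
      simp only [Pi.add_apply]
      nlinarith
  smul_mem' := by
    rintro c u ⟨hu, hu'⟩
    refine ⟨hu.const_smul c, (hu'.const_mul (‖c‖ ^ 2)).congr (ae_of_all _ fun z => ?_)⟩
    simp only [Pi.smul_apply, norm_smul]
    ring

/-- The Segal–Bargmann space `A²(ℂ, e^{-|z|²})` as a type of its own, so that it carries the
Hilbert space topology and not the topology of pointwise convergence. -/
def SegalBargmann : Type := segalBargmannSubmodule

namespace SegalBargmann

instance : AddCommGroup SegalBargmann := inferInstanceAs (AddCommGroup segalBargmannSubmodule)

instance : Module ℂ SegalBargmann := inferInstanceAs (Module ℂ segalBargmannSubmodule)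

/-- The inclusion of the Segal–Bargmann space into the space of all functions. -/
def toFun : SegalBargmann →ₗ[ℂ] (ℂ → ℂ) := segalBargmannSubmodule.subtype

instance : CoeFun SegalBargmann (fun _ => ℂ → ℂ) := ⟨fun u => toFun u⟩

/-- An entire function that is square integrable for the Gaussian weight, as an element. -/
def mk (u : ℂ → ℂ) (hu : u ∈ segalBargmannSubmodule) : SegalBargmann := ⟨u, hu⟩

theorem mk_apply (u : ℂ → ℂ) (hu : u ∈ segalBargmannSubmodule) (z : ℂ) : mk u hu z = u z := rfl

theorem coe_mem (u : SegalBargmann) : (u : ℂ → ℂ) ∈ segalBargmannSubmodule := u.2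

theorem toFun_injective : Function.Injective toFun := Subtype.val_injective

theorem differentiable (u : SegalBargmann) : Differentiable ℂ (u : ℂ → ℂ) := u.2.1

theorem continuous (u : SegalBargmann) : Continuous (u : ℂ → ℂ) := u.2.1.continuous

theorem integrable_normSq (u : SegalBargmann) :
    Integrable (fun z : ℂ => ‖u z‖ ^ 2 * Real.exp (-‖z‖ ^ 2)) volume := u.2.2

theorem add_apply (u v : SegalBargmann) (z : ℂ) : (u + v) z = u z + v z := rfl

theorem sub_apply (u v : SegalBargmann) (z : ℂ) : (u - v) z = u z - v z := rfl

theorem smul_apply (c : ℂ) (u : SegalBargmann) (z : ℂ) : (c • u) z = c * u z := rfl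

theorem integrable_inner (u v : SegalBargmann) :
    Integrable (fun z : ℂ => conj (u z) * v z * (Real.exp (-‖z‖ ^ 2) : ℂ)) volume := by
  refine (u.integrable_normSq.add v.integrable_normSq).mono' ?_ (ae_of_all _ fun z => ?_)
  · have h1 := u.continuous
    have h2 := v.continuous
    exact Continuous.aestronglyMeasurable (by fun_prop)
  · have he := Real.exp_pos (-‖z‖ ^ 2)
    rw [norm_mul, norm_mul, RCLike.norm_conj, Complex.norm_real, Real.norm_of_nonneg he.le]
    simp only [Pi.add_apply]
    have h3 : ‖u z‖ * ‖v z‖ ≤ ‖u z‖ ^ 2 + ‖v z‖ ^ 2 := by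
      nlinarith [sq_nonneg (‖u z‖ - ‖v z‖), sq_nonneg (‖u z‖), sq_nonneg (‖v z‖)]
    nlinarith

theorem integral_self (u : SegalBargmann) :
    ∫ z : ℂ, conj (u z) * u z * (Real.exp (-‖z‖ ^ 2) : ℂ)
      = ((∫ z : ℂ, ‖u z‖ ^ 2 * Real.exp (-‖z‖ ^ 2) : ℝ) : ℂ) := by
  rw [← integral_complex_ofReal]
  refine integral_congr_ae (ae_of_all _ fun z => ?_)
  simp only [Complex.conj_mul']
  push_cast
  rfl

/-- The inner product `∫ u(z) \overline{v(z)} e^{-|z|²} dλ(z)`; as everywhere in Mathlib, the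
conjugated factor is written first, `⟪v, u⟫`. -/
@[reducible] def core : InnerProductSpace.Core ℂ SegalBargmann where
  inner v u := ∫ z : ℂ, conj (v z) * u z * (Real.exp (-‖z‖ ^ 2) : ℂ)
  conj_inner_symm u v := by
    rw [← integral_conj]
    refine integral_congr_ae (ae_of_all _ fun z => ?_)
    simp only [map_mul, Complex.conj_conj, Complex.conj_ofReal]
    ring
  re_inner_nonneg u := by
    rw [integral_self]
    exact integral_nonneg fun z => by positivity
  add_left u v w := by
    rw [← integral_add (integrable_inner u w) (integrable_inner v w)]
    refine integral_congr_ae (ae_of_all _ fun z => ?_)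
    simp only [add_apply, map_add]
    ring
  smul_left u v c := by
    rw [← integral_const_mul]
    refine integral_congr_ae (ae_of_all _ fun z => ?_)
    simp only [smul_apply, map_mul]
    ring
  definite u hu := by
    rw [integral_self, Complex.ofReal_eq_zero] at hu
    have hc : Continuous fun z : ℂ => ‖u z‖ ^ 2 * Real.exp (-‖z‖ ^ 2) := by
      have h1 := u.continuous
      fun_prop
    rw [integral_eq_zero_iff_of_nonneg (fun z => by positivity) u.integrable_normSq,
      hc.ae_eq_iff_eq volume continuous_zero] at hu
    apply toFun_injective
    funext z
    have hz := congrFun hu z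
    simpa [(Real.exp_pos _).ne'] using hz

instance : NormedAddCommGroup SegalBargmann := core.toNormedAddCommGroup

instance : InnerProductSpace ℂ SegalBargmann := InnerProductSpace.ofCore core.toCore

theorem inner_def (v u : SegalBargmann) :
    inner ℂ v u = ∫ z : ℂ, conj (v z) * u z * (Real.exp (-‖z‖ ^ 2) : ℂ) := rfl

theorem norm_sq (u : SegalBargmann) :
    ‖u‖ ^ 2 = ∫ z : ℂ, ‖u z‖ ^ 2 * Real.exp (-‖z‖ ^ 2) := by
  rw [InnerProductSpace.norm_sq_eq_re_inner (𝕜 := ℂ), inner_def, integral_self]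
  rfl

/-- The mean value property over a disc of radius one. -/
theorem integral_ball_entire (f : ℂ → ℂ) (hf : Differentiable ℂ f) :
    ∫ z in Metric.ball (0 : ℂ) 1, f z = Real.pi * f 0 := by
  rw [← integral_indicator Metric.isOpen_ball.measurableSet,
    ← Complex.integral_comp_polarCoord_symm]
  have hcirc : ∀ r : ℝ, ∫ θ in Set.Ioo (-Real.pi) Real.pi, f (circleMap 0 r θ)
      = 2 * Real.pi * f 0 := by
    intro r
    have h1 := (hf.diffContOnCl (s := Metric.ball 0 |r|)).circleAverage
    rw [Real.circleAverage_def] at h1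
    have hper : Function.Periodic (fun θ => f (circleMap 0 r θ)) (2 * Real.pi) :=
      fun θ => by simp only [periodic_circleMap 0 r θ]
    have h2 := hper.intervalIntegral_add_eq 0 (-Real.pi)
    rw [zero_add, show -Real.pi + 2 * Real.pi = Real.pi by ring] at h2
    rw [h2, intervalIntegral.integral_of_le (by linarith [Real.pi_pos]),
      integral_Ioc_eq_integral_Ioo] at h1
    rw [← h1, Complex.real_smul]
    have := Complex.ofReal_ne_zero.2 Real.pi_ne_zero
    push_cast
    field_simp
  have hpol : ∀ p : ℝ × ℝ, Complex.polarCoord.symm p = circleMap 0 p.1 p.2 := by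
    intro p
    rw [Complex.polarCoord_symm_apply, circleMap, zero_add, Complex.exp_mul_I]
    push_cast
    rfl
  have hset : ∫ p in polarCoord.target, p.1 • (Metric.ball (0 : ℂ) 1).indicator f
        (Complex.polarCoord.symm p)
      = ∫ p in (Set.Ioo (0 : ℝ) 1) ×ˢ (Set.Ioo (-Real.pi) Real.pi),
          p.1 • f (circleMap 0 p.1 p.2) := by
    rw [← integral_indicator polarCoord.open_target.measurableSet,
      ← integral_indicator (measurableSet_Ioo.prod measurableSet_Ioo)]
    congr 1
    funext p
    rw [polarCoord_target]
    simp only [Set.indicator, Set.mem_prod, Set.mem_Ioi, Set.mem_Ioo, hpol, mem_ball_zero_iff,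
      norm_circleMap_zero]
    by_cases h0 : 0 < p.1
    · rw [abs_of_pos h0]
      by_cases h1 : p.1 < 1 <;> simp [h0, h1]
    · simp [h0]
  have hcont : Continuous fun p : ℝ × ℝ => p.1 • f (circleMap 0 p.1 p.2) := by
    have h1 := hf.continuous
    unfold circleMap
    fun_prop
  rw [hset, Measure.volume_eq_prod, setIntegral_prod]
  · simp only [integral_smul, hcirc]
    rw [integral_smul_const, ← integral_Ioc_eq_integral_Ioo,
      ← intervalIntegral.integral_of_le zero_le_one, integral_id, Complex.real_smul]
    push_cast
    ring
  · refine (hcont.continuousOn.integrableOn_compact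
      (isCompact_Icc.prod isCompact_Icc)).mono_set (t := Set.Icc (0 : ℝ) 1 ×ˢ
        Set.Icc (-Real.pi) Real.pi) ?_
    exact Set.prod_mono Set.Ioo_subset_Icc_self Set.Ioo_subset_Icc_self

/-- Point evaluations are bounded, uniformly on bounded sets. -/
theorem norm_apply_le (u : SegalBargmann) (c : ℂ) :
    ‖u c‖ ≤ Real.exp ((‖c‖ + 1) ^ 2) * ‖u‖ := by
  have h1 := integral_ball_entire (fun z => u (c + z) ^ 2)
    ((u.differentiable.comp (differentiable_id.const_add c)).pow 2)
  have hmaj : Integrable (fun z : ℂ => Real.exp ((‖c‖ + 1) ^ 2) *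
      (‖u (c + z)‖ ^ 2 * Real.exp (-‖c + z‖ ^ 2))) volume :=
    (u.integrable_normSq.comp_add_left c).const_mul _
  have h2 : ‖∫ z in Metric.ball (0 : ℂ) 1, u (c + z) ^ 2‖
      ≤ ∫ z in Metric.ball (0 : ℂ) 1, Real.exp ((‖c‖ + 1) ^ 2) *
          (‖u (c + z)‖ ^ 2 * Real.exp (-‖c + z‖ ^ 2)) := by
    refine norm_integral_le_of_norm_le hmaj.integrableOn ?_
    refine (ae_restrict_iff' Metric.isOpen_ball.measurableSet).2 (ae_of_all _ fun z hz => ?_)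
    rw [mem_ball_zero_iff] at hz
    have h3 : ‖c + z‖ ≤ ‖c‖ + 1 := (norm_add_le _ _).trans (by linarith)
    have h4 : 1 ≤ Real.exp ((‖c‖ + 1) ^ 2) * Real.exp (-‖c + z‖ ^ 2) := by
      rw [← Real.exp_add]
      apply Real.one_le_exp
      nlinarith [norm_nonneg (c + z), norm_nonneg c]
    rw [norm_pow]
    nlinarith [sq_nonneg ‖u (c + z)‖]
  have h5 : ∫ z in Metric.ball (0 : ℂ) 1, Real.exp ((‖c‖ + 1) ^ 2) *
          (‖u (c + z)‖ ^ 2 * Real.exp (-‖c + z‖ ^ 2))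
      ≤ Real.exp ((‖c‖ + 1) ^ 2) * ‖u‖ ^ 2 := by
    refine (setIntegral_le_integral hmaj (ae_of_all _ fun z => by positivity)).trans ?_
    rw [integral_const_mul, norm_sq,
      integral_add_left_eq_self (fun z => ‖u z‖ ^ 2 * Real.exp (-‖z‖ ^ 2)) c]
  rw [h1, norm_mul, Complex.norm_real, Real.norm_of_nonneg Real.pi_pos.le, norm_pow,
    add_zero] at h2
  have h6 : ‖u c‖ ^ 2 ≤ (Real.exp ((‖c‖ + 1) ^ 2) * ‖u‖) ^ 2 := by
    have h7 : 1 ≤ Real.exp ((‖c‖ + 1) ^ 2) := Real.one_le_exp (by positivity)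
    have h8 := Real.pi_gt_three
    have h9 : Real.exp ((‖c‖ + 1) ^ 2) * ‖u‖ ^ 2 ≤ (Real.exp ((‖c‖ + 1) ^ 2) * ‖u‖) ^ 2 := by
      rw [mul_pow]
      gcongr
      nlinarith
    nlinarith [sq_nonneg ‖u c‖]
  exact le_of_sq_le_sq h6 (by positivity)

/-- The Segal–Bargmann space is a Hilbert space. -/
instance : CompleteSpace SegalBargmann := by
  refine Metric.complete_of_cauchySeq_tendsto fun U hU => ?_
  rw [Metric.cauchySeq_iff] at hU
  have hpt : ∀ z, CauchySeq fun n => U n z := by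
    intro z
    rw [Metric.cauchySeq_iff]
    intro ε hε
    obtain ⟨N, hN⟩ := hU (ε / Real.exp ((‖z‖ + 1) ^ 2)) (by positivity)
    refine ⟨N, fun m hm n hn => ?_⟩
    have h1 := norm_apply_le (U m - U n) z
    have h2 := hN m hm n hn
    rw [dist_eq_norm, lt_div_iff₀ (Real.exp_pos _)] at h2
    rw [dist_eq_norm, ← sub_apply]
    linarith
  choose f hf using fun z => cauchySeq_tendsto_of_complete (hpt z)
  have hlu : TendstoLocallyUniformlyOn (fun n => (U n : ℂ → ℂ)) f atTop Set.univ := by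
    rw [tendstoLocallyUniformlyOn_iff_forall_isCompact isOpen_univ]
    intro K _ hK
    obtain ⟨R, hR⟩ := hK.isBounded.exists_norm_le
    rw [Metric.tendstoUniformlyOn_iff]
    intro ε hε
    have hR' : 0 < Real.exp ((|R| + 1) ^ 2) := Real.exp_pos _
    obtain ⟨N, hN⟩ := hU (ε / 2 / Real.exp ((|R| + 1) ^ 2)) (by positivity)
    filter_upwards [eventually_ge_atTop N] with n hn z hz
    have hlim : Tendsto (fun m => dist (U m z) (U n z)) atTop (𝓝 (dist (f z) (U n z))) :=
      (hf z).dist tendsto_const_nhds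
    refine lt_of_le_of_lt (le_of_tendsto hlim ?_) (half_lt_self hε)
    filter_upwards [eventually_ge_atTop N] with m hm
    have h1 := norm_apply_le (U m - U n) z
    have h2 := hN m hm n hn
    rw [dist_eq_norm, lt_div_iff₀ hR'] at h2
    rw [dist_eq_norm, ← sub_apply]
    have h3 : Real.exp ((‖z‖ + 1) ^ 2) ≤ Real.exp ((|R| + 1) ^ 2) := by
      gcongr
      exact (hR z hz).trans (le_abs_self R)
    nlinarith [norm_nonneg (U m - U n)]
  have hfd : Differentiable ℂ f := by
    rw [← differentiableOn_univ]
    exact hlu.differentiableOn (Eventually.of_forall fun n => (U n).differentiable.differentiableOn)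
      isOpen_univ
  have hkey : ∀ ε : ℝ, 0 < ε → ∃ N, ∀ n ≥ N,
      ∫⁻ z : ℂ, ENNReal.ofReal (‖U n z - f z‖ ^ 2 * Real.exp (-‖z‖ ^ 2))
        ≤ ENNReal.ofReal (ε ^ 2) := by
    intro ε hε
    obtain ⟨N, hN⟩ := hU ε hε
    refine ⟨N, fun n hn => ?_⟩
    have hlim : ∀ z : ℂ, Tendsto
        (fun m => ENNReal.ofReal (‖U n z - U m z‖ ^ 2 * Real.exp (-‖z‖ ^ 2))) atTop
        (𝓝 (ENNReal.ofReal (‖U n z - f z‖ ^ 2 * Real.exp (-‖z‖ ^ 2)))) := fun z =>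
      ENNReal.tendsto_ofReal
        ((((tendsto_const_nhds.sub (hf z)).norm).pow 2).mul tendsto_const_nhds)
    calc _ = ∫⁻ z : ℂ, liminf
          (fun m => ENNReal.ofReal (‖U n z - U m z‖ ^ 2 * Real.exp (-‖z‖ ^ 2))) atTop :=
          lintegral_congr fun z => (hlim z).liminf_eq.symm
      _ ≤ liminf (fun m => ∫⁻ z : ℂ,
          ENNReal.ofReal (‖U n z - U m z‖ ^ 2 * Real.exp (-‖z‖ ^ 2))) atTop := by
          refine lintegral_liminf_le fun m => ?_
          have h1 := (U n).continuous
          have h2 := (U m).continuous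
          exact (Continuous.measurable (((h1.sub h2).norm.pow 2).mul
            (by fun_prop))).ennreal_ofReal
      _ ≤ ENNReal.ofReal (ε ^ 2) := by
          refine liminf_le_of_frequently_le' (Eventually.frequently ?_)
          filter_upwards [eventually_ge_atTop N] with m hm
          have h1 := (U n - U m).integrable_normSq
          have h2 := norm_sq (U n - U m)
          simp only [sub_apply] at h1 h2
          rw [← ofReal_integral_eq_lintegral_ofReal h1 (ae_of_all _ fun z => by positivity), ← h2]
          have h3 := hN n hn m hm
          rw [dist_eq_norm] at h3
          gcongr
  have hmem : ∀ n, (∫⁻ z : ℂ, ENNReal.ofReal (‖U n z - f z‖ ^ 2 * Real.exp (-‖z‖ ^ 2)) < ⊤) →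
      (fun z => U n z - f z) ∈ segalBargmannSubmodule := by
    intro n hn
    refine ⟨(U n).differentiable.sub hfd, ?_⟩
    have h1 := (U n).continuous
    have h2 := hfd.continuous
    refine ⟨(((h1.sub h2).norm.pow 2).mul (by fun_prop)).aestronglyMeasurable, ?_⟩
    rwa [hasFiniteIntegral_iff_ofReal (ae_of_all _ fun z => by positivity)]
  obtain ⟨N, hN⟩ := hkey 1 one_pos
  have hfm : f ∈ segalBargmannSubmodule := by
    have h1 := segalBargmannSubmodule.sub_mem (U N).coe_mem
      (hmem N ((hN N le_rfl).trans_lt ENNReal.ofReal_lt_top))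
    convert h1 using 1
    funext z
    simp
  refine ⟨mk f hfm, Metric.tendsto_atTop.2 fun ε hε => ?_⟩
  obtain ⟨M, hM⟩ := hkey (ε / 2) (half_pos hε)
  refine ⟨M, fun n hn => ?_⟩
  have h1 := norm_sq (U n - mk f hfm)
  have h2 := (U n - mk f hfm).integrable_normSq
  simp only [sub_apply, mk_apply] at h1 h2
  have h3 := hM n hn
  rw [← ofReal_integral_eq_lintegral_ofReal h2 (ae_of_all _ fun z => by positivity), ← h1,
    ENNReal.ofReal_le_ofReal_iff (by positivity)] at h3
  rw [dist_eq_norm]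
  exact (le_of_sq_le_sq h3 (by positivity)).trans_lt (half_lt_self hε)

end SegalBargmann

/-- The constant coefficient operator `p_m(u) = a_0 u + a_1 u' + ⋯ + a_m u^{(m)}`. -/
def polyDiff (m : ℕ) (a : ℕ → ℂ) (u : ℂ → ℂ) : ℂ → ℂ :=
  fun z => ∑ k ∈ Finset.range (m + 1), a k * iteratedDeriv k u z

theorem polyDiff_add (m : ℕ) (a : ℕ → ℂ) {u v : ℂ → ℂ} (hu : Differentiable ℂ u)
    (hv : Differentiable ℂ v) : polyDiff m a (u + v) = polyDiff m a u + polyDiff m a v := by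
  funext z
  simp only [polyDiff, Pi.add_apply, ← Finset.sum_add_distrib]
  refine Finset.sum_congr rfl fun k _ => ?_
  rw [iteratedDeriv_add hu.contDiff.contDiffAt hv.contDiff.contDiffAt, mul_add]

theorem polyDiff_smul (m : ℕ) (a : ℕ → ℂ) (c : ℂ) {u : ℂ → ℂ} (hu : Differentiable ℂ u) :
    polyDiff m a (c • u) = c • polyDiff m a u := by
  funext z
  simp only [polyDiff, Pi.smul_apply, smul_eq_mul, Finset.mul_sum]
  refine Finset.sum_congr rfl fun k _ => ?_
  rw [iteratedDeriv_const_smul hu.contDiff.contDiffAt, smul_eq_mul]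
  ring

/-- The unbounded operator `D u = p_m(u) dz` with its maximal domain
`{u ∈ A² : p_m(u) ∈ A²}`. A `(1,0)`-form `f dz` with coefficient in `A²` has the norm of `f`,
and is identified with its coefficient `f`. -/
def opD (m : ℕ) (a : ℕ → ℂ) : SegalBargmann →ₗ.[ℂ] SegalBargmann where
  domain :=
    { carrier := {u | polyDiff m a u ∈ segalBargmannSubmodule}
      zero_mem' := by
        have h : polyDiff m a (0 : ℂ → ℂ) = 0 := by
          have := polyDiff_smul m a 0 (differentiable_const (𝕜 := ℂ) (E := ℂ) (0 : ℂ))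
          rw [zero_smul, zero_smul] at this
          exact this
        rw [Set.mem_ofPred_eq, map_zero, h]
        exact segalBargmannSubmodule.zero_mem
      add_mem' := by
        intro u v hu hv
        rw [Set.mem_ofPred_eq] at hu hv ⊢
        rw [map_add, polyDiff_add m a u.differentiable v.differentiable]
        exact segalBargmannSubmodule.add_mem hu hv
      smul_mem' := by
        intro c u hu
        rw [Set.mem_ofPred_eq] at hu ⊢
        rw [map_smul, polyDiff_smul m a c u.differentiable]
        exact segalBargmannSubmodule.smul_mem c hu }
  toFun :=
    { toFun := fun u => SegalBargmann.mk (polyDiff m a u.1) u.2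
      map_add' := fun u v => SegalBargmann.toFun_injective
        (polyDiff_add m a u.1.differentiable v.1.differentiable)
      map_smul' := fun c u => SegalBargmann.toFun_injective
        (polyDiff_smul m a c u.1.differentiable) }

/-- The Hilbert space adjoint `D*` of `D`. -/
def opDstar (m : ℕ) (a : ℕ → ℂ) : SegalBargmann →ₗ.[ℂ] SegalBargmann :=
  (opD m a).adjoint

/-- The box operator `D D*` with domain `{f ∈ dom(D*) : D* f ∈ dom(D)}`. -/
def boxD (m : ℕ) (a : ℕ → ℂ) : SegalBargmann →ₗ.[ℂ] SegalBargmann where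
  domain :=
    { carrier := {f | ∃ h : f ∈ (opDstar m a).domain, opDstar m a ⟨f, h⟩ ∈ (opD m a).domain}
      zero_mem' := by
        refine ⟨zero_mem _, ?_⟩
        have h : opDstar m a ⟨0, zero_mem _⟩ = 0 := (opDstar m a).map_zero
        rw [h]
        exact zero_mem _
      add_mem' := by
        rintro f g ⟨hf, hf'⟩ ⟨hg, hg'⟩
        refine ⟨add_mem hf hg, ?_⟩
        have h : opDstar m a ⟨f + g, add_mem hf hg⟩
            = opDstar m a ⟨f, hf⟩ + opDstar m a ⟨g, hg⟩ :=
          (opDstar m a).map_add ⟨f, hf⟩ ⟨g, hg⟩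
        rw [h]
        exact add_mem hf' hg'
      smul_mem' := by
        rintro c f ⟨hf, hf'⟩
        refine ⟨Submodule.smul_mem _ c hf, ?_⟩
        have h : opDstar m a ⟨c • f, Submodule.smul_mem _ c hf⟩ = c • opDstar m a ⟨f, hf⟩ :=
          (opDstar m a).map_smul c ⟨f, hf⟩
        rw [h]
        exact Submodule.smul_mem _ c hf' }
  toFun :=
    { toFun := fun f => opD m a ⟨opDstar m a ⟨f.1, f.2.1⟩, f.2.2⟩
      map_add' := fun f g => by
        rw [← LinearPMap.map_add]
        congr 1
        exact Subtype.ext ((opDstar m a).map_add ⟨f.1, f.2.1⟩ ⟨g.1, g.2.1⟩)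
      map_smul' := fun c f => by
        rw [RingHom.id_apply, ← LinearPMap.map_smul]
        congr 1
        exact Subtype.ext ((opDstar m a).map_smul c ⟨f.1, f.2.1⟩) }

/-- The kernel of `D`, a subspace of the Segal–Bargmann space. -/
def kerD (m : ℕ) (a : ℕ → ℂ) : Submodule ℂ SegalBargmann :=
  (LinearMap.ker (opD m a).toFun).map (opD m a).domain.subtype

/-- The image of `D*`, a subspace of the Segal–Bargmann space. -/
def imDstar (m : ℕ) (a : ℕ → ℂ) : Submodule ℂ SegalBargmann :=
  LinearMap.range (opDstar m a).toFun

end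

/-! Testing `D*` against the reproducing kernels `z ↦ exp (conj w * z)`, which are eigenfunctions of
`D`, shows that `D*` is multiplication by the polynomial `q = ∑ conj (aₖ) zᵏ`. Since `q` is nonzero,
`|q|` is bounded below outside a disc, and inside the disc the maximum modulus principle takes over:
hence `‖f‖ ≤ K ‖D* f‖`. Point evaluations of derivatives are continuous, so `D` is closed and
`D** = D`. Therefore `D*` has closed range, equal to `(ker D)ᗮ`, and a bounded left inverse `B`,
chosen to vanish on `ker D`. The adjoint `A = B*` sends `α` to the canonical solution of `D u = α`,
and `N = A* A` inverts `D D*`.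
-/

section ClosedOperator

variable {𝕜 E F : Type*}

theorem isClosed_range_of_antilipschitzWith [NormedField 𝕜] [NormedAddCommGroup E]
    [NormedSpace 𝕜 E] [CompleteSpace E] [NormedAddCommGroup F] [NormedSpace 𝕜 F] [CompleteSpace F]
    {S : E →ₗ.[𝕜] F} (hS : S.IsClosed) {K : NNReal} (hK : AntilipschitzWith K S) :
    IsClosed (LinearMap.range S.toFun : Set F) := by
  have : CompleteSpace S.graph := hS.completeSpace_coe
  have hsnd : AntilipschitzWith (max K 1) fun p : S.graph => p.1.2 := by
    rintro ⟨p, hp⟩ ⟨q, hq⟩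
    obtain ⟨x, rfl⟩ := S.mem_graph_iff'.1 hp
    obtain ⟨y, rfl⟩ := S.mem_graph_iff'.1 hq
    rw [Subtype.edist_eq, Prod.edist_eq, max_le_iff]
    constructor
    · exact (hK x y).trans (mul_le_mul_left (mod_cast le_max_left K 1) _)
    · exact le_mul_of_one_le_left zero_le (mod_cast le_max_right K 1)
  have hrange : Set.range (fun p : S.graph => p.1.2) = LinearMap.range S.toFun := by
    rw [← S.graph_map_snd_eq_range]
    ext y
    simp
  rw [← hrange]
  exact hsnd.isClosed_range (uniformContinuous_snd.comp uniformContinuous_subtype_val)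

theorem exists_leftInverse_of_antilipschitzWith [RCLike 𝕜] [NormedAddCommGroup E]
    [NormedSpace 𝕜 E] [CompleteSpace E] [NormedAddCommGroup F] [InnerProductSpace 𝕜 F]
    [CompleteSpace F] {S : E →ₗ.[𝕜] F} (hS : S.IsClosed) {K : NNReal}
    (hK : AntilipschitzWith K S) :
    ∃ B : F →L[𝕜] E, (∀ x : S.domain, B (S x) = x) ∧
      ∀ y ∈ (LinearMap.range S.toFun)ᗮ, B y = 0 := by
  set R := LinearMap.range S.toFun
  have : CompleteSpace R := (isClosed_range_of_antilipschitzWith hS hK).completeSpace_coe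
  let e : S.domain ≃ₗ[𝕜] R := LinearEquiv.ofInjective S.toFun hK.injective
  let L : R →L[𝕜] E := (S.domain.subtype ∘ₗ e.symm.toLinearMap).mkContinuous K fun y => by
    have h := hK.le_mul_dist (e.symm y) 0
    rw [S.map_zero, dist_zero_right, dist_zero_right] at h
    rwa [show S (e.symm y) = y from congrArg Subtype.val (e.apply_symm_apply y)] at h
  refine ⟨L ∘L R.orthogonalProjectionOnto, fun x => ?_, fun y hy => ?_⟩
  · have hproj : R.orthogonalProjectionOnto (S x) = e x :=
      Submodule.orthogonalProjectionOnto_mem_subspace_eq_self (e x)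
    rw [ContinuousLinearMap.comp_apply, hproj]
    exact congrArg Subtype.val (e.symm_apply_apply x)
  · rw [ContinuousLinearMap.comp_apply,
      Submodule.orthogonalProjectionOnto_apply_of_mem_orthogonal hy, map_zero]

variable [RCLike 𝕜] [NormedAddCommGroup E] [InnerProductSpace 𝕜 E] [NormedAddCommGroup F]
  [InnerProductSpace 𝕜 F] {T : E →ₗ.[𝕜] F}

/-- The kernel of an unbounded operator, as a subspace of the ambient space and not of the
domain. -/
def operatorKernel (T : E →ₗ.[𝕜] F) : Submodule 𝕜 E :=
  (LinearMap.ker T.toFun).map T.domain.subtype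

theorem mem_operatorKernel_iff {u : E} : u ∈ operatorKernel T ↔ (u, 0) ∈ T.graph := by
  simp only [operatorKernel, Submodule.mem_map, LinearMap.mem_ker, LinearPMap.mem_graph_iff,
    and_comm]
  rfl

/-- `A` is the canonical solution operator of `T`: `A α` is the solution of `T u = α` that is
orthogonal to the kernel of `T`, hence the solution of minimal norm. -/
def IsCanonicalSolutionOperator (T : E →ₗ.[𝕜] F) (A : F →L[𝕜] E) : Prop :=
  ∀ α, (A α, α) ∈ T.graph ∧ A α ∈ (operatorKernel T)ᗮ

theorem IsCanonicalSolutionOperator.eq_of_mem_graph {A : F →L[𝕜] E}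
    (hA : IsCanonicalSolutionOperator T A) {u : E} {α : F} (hu : (u, α) ∈ T.graph)
    (hu' : u ∈ (operatorKernel T)ᗮ) : A α = u := by
  obtain ⟨hAα, hAα'⟩ := hA α
  have hker : A α - u ∈ operatorKernel T := by
    rw [mem_operatorKernel_iff]
    simpa using sub_mem hAα hu
  exact sub_eq_zero.1 (Submodule.disjoint_def.1 (Submodule.orthogonal_disjoint _) _ hker
    (sub_mem hAα' hu'))

variable [CompleteSpace E]

theorem inner_adjoint_eq_of_mem_graph (hT : Dense (T.domain : Set E)) {u : E} {α : F}
    (h : (u, α) ∈ T.graph) (g : T.adjoint.domain) :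
    inner 𝕜 (T.adjoint g) u = inner 𝕜 (g : F) α := by
  obtain ⟨x, rfl, rfl⟩ := T.mem_graph_iff.1 h
  exact LinearPMap.adjoint_isFormalAdjoint hT g x

variable [CompleteSpace F]

theorem adjoint_adjoint_le_of_isClosed {G : Submodule 𝕜 (E × F)}
    (hG : IsClosed (G : Set (E × F))) : G.adjoint.adjoint ≤ G := by
  -- `G.adjoint` is `Gᗮ` rotated by `(x, y) ↦ (y, -x)`, so `G.adjoint.adjoint` is `Gᗮᗮ`.
  intro x hx
  rw [Submodule.mem_adjoint_iff] at hx
  let e := (WithLp.prodContinuousLinearEquiv 2 𝕜 E F).symm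
  let G₂ : Submodule 𝕜 (WithLp 2 (E × F)) := G.map e.toLinearEquiv.toLinearMap
  have hG₂ : IsClosed (G₂ : Set (WithLp 2 (E × F))) := by
    rw [Submodule.map_coe]
    exact e.toHomeomorph.isClosedMap _ hG
  have : CompleteSpace G₂ := hG₂.completeSpace_coe
  suffices e x ∈ G₂ᗮᗮ by
    rw [Submodule.orthogonal_orthogonal] at this
    obtain ⟨y, hy, hyx⟩ := this
    rwa [← e.injective hyx]
  intro y hy
  have hrot : (y.snd, -y.fst) ∈ G.adjoint := by
    rw [Submodule.mem_adjoint_iff]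
    intro a b hab
    have := hy (e (a, b)) ⟨(a, b), hab, rfl⟩
    rw [WithLp.prod_inner_apply] at this
    simpa [e, add_comm] using this
  have := hx _ _ hrot
  rw [inner_neg_left, ← neg_add', neg_eq_zero] at this
  rwa [WithLp.prod_inner_apply]

theorem mem_graph_of_inner_adjoint_eq (hT : Dense (T.domain : Set E)) (hcl : T.IsClosed) {u : E}
    {α : F} (h : ∀ g : T.adjoint.domain, inner 𝕜 (T.adjoint g) u = inner 𝕜 (g : F) α) :
    (u, α) ∈ T.graph := by
  apply adjoint_adjoint_le_of_isClosed hcl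
  rw [← T.adjoint_graph_eq_graph_adjoint hT, Submodule.mem_adjoint_iff]
  intro a b hab
  obtain ⟨g, rfl, rfl⟩ := T.adjoint.mem_graph_iff.1 hab
  exact sub_eq_zero.2 (h g)

theorem orthogonal_range_adjoint (hT : Dense (T.domain : Set E)) (hcl : T.IsClosed) :
    (LinearMap.range T.adjoint.toFun)ᗮ = operatorKernel T := by
  ext u
  rw [mem_operatorKernel_iff, Submodule.mem_orthogonal]
  constructor
  · intro hu
    refine mem_graph_of_inner_adjoint_eq hT hcl fun g => ?_
    rw [inner_zero_right]
    exact hu _ ⟨g, rfl⟩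
  · rintro hu _ ⟨g, rfl⟩
    exact (inner_adjoint_eq_of_mem_graph hT hu g).trans (inner_zero_right _)

theorem orthogonal_operatorKernel (hT : Dense (T.domain : Set E)) (hcl : T.IsClosed)
    {K : NNReal} (hK : AntilipschitzWith K T.adjoint) :
    (operatorKernel T)ᗮ = LinearMap.range T.adjoint.toFun := by
  have hrange := isClosed_range_of_antilipschitzWith (LinearPMap.adjoint_isClosed hT) hK
  rw [← orthogonal_range_adjoint hT hcl, Submodule.orthogonal_orthogonal_eq_closure,
    hrange.submodule_topologicalClosure_eq]

theorem exists_isCanonicalSolutionOperator (hT : Dense (T.domain : Set E)) (hcl : T.IsClosed)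
    {K : NNReal} (hK : AntilipschitzWith K T.adjoint) :
    ∃ A : F →L[𝕜] E, IsCanonicalSolutionOperator T A := by
  obtain ⟨B, hB, hB₀⟩ := exists_leftInverse_of_antilipschitzWith (LinearPMap.adjoint_isClosed hT) hK
  refine ⟨B.adjoint, fun α => ⟨mem_graph_of_inner_adjoint_eq hT hcl fun g => ?_, fun u hu => ?_⟩⟩
  · rw [ContinuousLinearMap.adjoint_inner_right, hB]
  · rw [← orthogonal_range_adjoint hT hcl] at hu
    rw [ContinuousLinearMap.adjoint_inner_right, hB₀ u hu, inner_zero_left]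

namespace IsCanonicalSolutionOperator

variable {A : F →L[𝕜] E} (hA : IsCanonicalSolutionOperator T A)
include hA

theorem adjoint_leftInverse (hT : Dense (T.domain : Set E)) (g : T.adjoint.domain) :
    A.adjoint (T.adjoint g) = g := by
  refine ext_inner_right 𝕜 fun α => ?_
  rw [ContinuousLinearMap.adjoint_inner_left, inner_adjoint_eq_of_mem_graph hT (hA α).1]

theorem exists_adjoint_comp_self (hT : Dense (T.domain : Set E)) (hcl : T.IsClosed)
    {K : NNReal} (hK : AntilipschitzWith K T.adjoint) (α : F) :
    ∃ (h : A.adjoint (A α) ∈ T.adjoint.domain) (h' : T.adjoint ⟨_, h⟩ ∈ T.domain),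
      T ⟨_, h'⟩ = α ∧ T.adjoint ⟨_, h⟩ = A α := by
  obtain ⟨hAα, hAα'⟩ := hA α
  rw [orthogonal_operatorKernel hT hcl hK] at hAα'
  obtain ⟨g, hg : T.adjoint g = A α⟩ := hAα'
  rw [show A.adjoint (A α) = g by rw [← hg, hA.adjoint_leftInverse hT]]
  have hdom : T.adjoint g ∈ T.domain := hg ▸ T.mem_domain_of_mem_graph hAα
  exact ⟨g.2, hdom, T.mem_graph_snd_inj (T.mem_graph ⟨_, hdom⟩) hAα hg, hg⟩

theorem adjoint_comp_self_eq (hT : Dense (T.domain : Set E)) (hcl : T.IsClosed)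
    {K : NNReal} (hK : AntilipschitzWith K T.adjoint) {f : T.adjoint.domain} {α : F}
    (hf : (T.adjoint f, α) ∈ T.graph) : A.adjoint (A α) = f := by
  have hmem : T.adjoint f ∈ (operatorKernel T)ᗮ :=
    orthogonal_operatorKernel hT hcl hK ▸ ⟨f, rfl⟩
  rw [hA.eq_of_mem_graph hf hmem, hA.adjoint_leftInverse hT]

end IsCanonicalSolutionOperator

end ClosedOperator

theorem measurePreserving_circle_mul (ζ : Circle) :
    MeasurePreserving (fun z : ℂ => ζ * z) :=
  (rotation ζ).measurePreserving

theorem integral_circleMap_mul {g : ℂ → ℂ} (hg : Differentiable ℂ g) (z : ℂ) :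
    ∫ θ in (0)..2 * Real.pi, g (circleMap 0 1 θ * z) = (2 * Real.pi : ℝ) • g 0 := by
  have hmean := (hg.comp (differentiable_id.mul_const z)).diffContOnCl
    (s := Metric.ball 0 |1|) |>.circleAverage
  rw [Real.circleAverage, inv_smul_eq_iff₀ Real.two_pi_pos.ne'] at hmean
  simpa using hmean

theorem integrable_circleMap_mul_prod {h : ℂ → ℂ} (hh : Integrable h) (ν : Measure ℝ)
    [IsFiniteMeasure ν] :
    Integrable (fun p : ℝ × ℂ => h (circleMap 0 1 p.1 * p.2)) (ν.prod volume) := by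
  have hrot : MeasurePreserving (fun p : ℝ × ℂ => (p.1, circleMap 0 1 p.1 * p.2))
      (ν.prod volume) (ν.prod volume) := by
    refine (MeasurePreserving.id ν).skew_product (g := fun θ z => circleMap 0 1 θ * z)
      (by fun_prop) (ae_of_all _ fun θ => ?_)
    simpa [circleMap] using (measurePreserving_circle_mul (Circle.exp θ)).map_eq
  exact hrot.integrable_comp_of_integrable (hh.comp_snd _)

theorem integral_mul_radial {g : ℂ → ℂ} (hg : Differentiable ℂ g) {ρ : ℝ → ℂ}
    (hgρ : Integrable fun z => g z * ρ ‖z‖) :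
    ∫ z, g z * ρ ‖z‖ = g 0 * ∫ z : ℂ, ρ ‖z‖ := by
  have hrot (θ : ℝ) : ∫ z, g (circleMap 0 1 θ * z) * ρ ‖z‖ = ∫ z, g z * ρ ‖z‖ := by
    have := (measurePreserving_circle_mul (Circle.exp θ)).integral_comp
      (rotation (Circle.exp θ)).toHomeomorph.measurableEmbedding fun z => g z * ρ ‖z‖
    simpa [circleMap] using this
  have : IsFiniteMeasure (volume.restrict (Set.uIoc 0 (2 * Real.pi))) := by
    rw [Set.uIoc_of_le Real.two_pi_pos.le]
    infer_instance
  have hint := integrable_circleMap_mul_prod hgρ (volume.restrict (Set.uIoc 0 (2 * Real.pi)))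
  simp only [norm_mul, norm_circleMap_zero, abs_one, one_mul] at hint
  have hpi : (2 * Real.pi : ℝ) ≠ 0 := Real.two_pi_pos.ne'
  refine smul_right_injective ℂ hpi ?_
  calc (2 * Real.pi : ℝ) • ∫ z, g z * ρ ‖z‖
    _ = ∫ θ in (0)..2 * Real.pi, ∫ z, g (circleMap 0 1 θ * z) * ρ ‖z‖ := by simp [hrot]
    _ = ∫ z, ∫ θ in (0)..2 * Real.pi, g (circleMap 0 1 θ * z) * ρ ‖z‖ :=
      intervalIntegral_integral_swap hint
    _ = ∫ z : ℂ, (2 * Real.pi : ℝ) • (g 0 * ρ ‖z‖) := by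
      simp only [intervalIntegral.integral_mul_const, integral_circleMap_mul hg, smul_mul_assoc]
    _ = (2 * Real.pi : ℝ) • (g 0 * ∫ z : ℂ, ρ ‖z‖) := by
      rw [integral_smul, integral_const_mul]

theorem integral_mul_gaussian {g : ℂ → ℂ} (hg : Differentiable ℂ g)
    (hgi : Integrable fun z : ℂ => g z * (Real.exp (-‖z‖ ^ 2) : ℂ)) :
    ∫ z : ℂ, g z * (Real.exp (-‖z‖ ^ 2) : ℂ) = Real.pi * g 0 := by
  have hgauss : ∫ z : ℂ, Real.exp (-‖z‖ ^ 2) = Real.pi := by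
    simpa using GaussianFourier.integral_rexp_neg_mul_sq_norm (V := ℂ) one_pos
  rw [integral_mul_radial (ρ := fun r => (Real.exp (-r ^ 2) : ℂ)) hg hgi,
    integral_complex_ofReal, hgauss, mul_comm]

theorem exists_pos_le_norm_eval {q : Polynomial ℂ} (hq : q ≠ 0) :
    ∃ δ > 0, ∃ R, ∀ z : ℂ, R ≤ ‖z‖ → δ ≤ ‖q.eval z‖ := by
  rcases le_or_gt q.degree 0 with hdeg | hdeg
  · rw [Polynomial.eq_C_of_degree_le_zero hdeg] at hq ⊢
    exact ⟨‖q.coeff 0‖, norm_pos_iff.2 (Polynomial.C_ne_zero.1 hq), 0, fun z _ => by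
      rw [Polynomial.eval_C]⟩
  · have hlarge := (q.tendsto_norm_atTop hdeg tendsto_norm_cobounded_atTop).eventually_ge_atTop 1
    rw [← comap_norm_atTop, eventually_comap] at hlarge
    obtain ⟨R, hR⟩ := eventually_atTop.1 hlarge
    exact ⟨1, one_pos, R, fun z hz => hR ‖z‖ hz z rfl⟩

namespace SegalBargmann

theorem exp_mem_segalBargmannSubmodule (c : ℂ) :
    (fun z => Complex.exp (c * z)) ∈ segalBargmannSubmodule := by
  refine ⟨by fun_prop, ?_⟩
  have hgauss := (GaussianFourier.integrable_cexp_neg_mul_sq_norm_add (V := ℂ) (b := 1)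
    (by simp) 2 (conj c)).norm
  refine hgauss.congr (ae_of_all _ fun z => ?_)
  have hre :
      (-1 * (‖z‖ : ℂ) ^ 2 + 2 * (inner ℝ (conj c) z : ℝ)).re = 2 * (c * z).re + -‖z‖ ^ 2 := by
    rw [Complex.inner, Complex.conj_conj, mul_comm z, neg_one_mul, add_comm, Complex.add_re,
      Complex.neg_re, ← Complex.ofReal_pow, Complex.ofReal_re, Complex.re_mul_ofReal,
      Complex.re_ofNat]
  change ‖Complex.exp _‖ = ‖Complex.exp (c * z)‖ ^ 2 * Real.exp (-‖z‖ ^ 2)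
  rw [Complex.norm_exp, hre, Complex.norm_exp, Real.exp_add, ← Real.exp_nat_mul, Nat.cast_ofNat]

/-- The reproducing kernel `z ↦ exp (conj w * z)` of the Segal–Bargmann space at `w`, up to the
factor `1 / π`. -/
noncomputable def kernel (w : ℂ) : SegalBargmann :=
  mk (fun z => Complex.exp (conj w * z)) (exp_mem_segalBargmannSubmodule _)

theorem kernel_apply (w z : ℂ) : kernel w z = Complex.exp (conj w * z) := rfl

theorem inner_kernel_left (w : ℂ) (u : SegalBargmann) :
    inner ℂ (kernel w) u = Real.pi * u w := by
  let g : ℂ → ℂ := fun z => u (z + w) * Complex.exp (-(conj w * z))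
  have hg : Differentiable ℂ g := by
    have := u.differentiable
    fun_prop
  have htrans (z : ℂ) : conj (kernel w (z + w)) * u (z + w) * (Real.exp (-‖z + w‖ ^ 2) : ℂ)
      = g z * (Real.exp (-‖z‖ ^ 2) : ℂ) := by
    have hexp : Complex.exp (w * conj (z + w)) * Complex.exp (-((z + w) * conj (z + w)))
        = Complex.exp (-(conj w * z)) * Complex.exp (-(z * conj z)) := by
      rw [← Complex.exp_add, ← Complex.exp_add, map_add]
      ring_nf
    simp only [kernel_apply, ← Complex.exp_conj, map_mul, Complex.conj_conj, g]
    push_cast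
    rw [← Complex.mul_conj', ← Complex.mul_conj']
    linear_combination u (z + w) * hexp
  have hint : Integrable fun z => g z * (Real.exp (-‖z‖ ^ 2) : ℂ) := by
    simp only [← htrans]
    exact ((kernel w).integrable_inner u).comp_add_right w
  calc inner ℂ (kernel w) u
    _ = ∫ z, g z * (Real.exp (-‖z‖ ^ 2) : ℂ) := by
      rw [inner_def, ← integral_add_right_eq_self _ w]
      exact integral_congr_ae (ae_of_all _ htrans)
    _ = Real.pi * u w := by
      rw [integral_mul_gaussian hg hint]
      simp [g]

theorem dense_of_kernel_mem {K : Submodule ℂ SegalBargmann} (hK : ∀ w, kernel w ∈ K) :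
    Dense (K : Set SegalBargmann) := by
  rw [Submodule.dense_iff_topologicalClosure_eq_top, Submodule.topologicalClosure_eq_top_iff,
    Submodule.eq_bot_iff]
  refine fun u hu => toFun_injective (funext fun w => ?_)
  have horth := hu _ (hK w)
  rw [inner_kernel_left, mul_eq_zero] at horth
  exact horth.resolve_left (mod_cast Real.pi_ne_zero)

theorem norm_iteratedDeriv_le (k : ℕ) (w : ℂ) (u : SegalBargmann) :
    ‖iteratedDeriv k u w‖ ≤ k.factorial * Real.exp ((‖w‖ + 2) ^ 2) * ‖u‖ := by
  have hcauchy := Complex.norm_iteratedDeriv_le_of_forall_mem_sphere_norm_le k one_pos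
    (C := Real.exp ((‖w‖ + 2) ^ 2) * ‖u‖) u.differentiable.diffContOnCl (c := w) fun z hz => by
      have hzw : ‖z‖ ≤ ‖w‖ + 1 := by
        rw [← mem_sphere_iff_norm.1 hz]
        exact norm_le_norm_add_norm_sub' z w
      have hzw' : ‖z‖ + 1 ≤ ‖w‖ + 2 := by linarith
      calc ‖u z‖ ≤ Real.exp ((‖z‖ + 1) ^ 2) * ‖u‖ := u.norm_apply_le z
        _ ≤ Real.exp ((‖w‖ + 2) ^ 2) * ‖u‖ := by gcongr
  simpa [mul_assoc] using hcauchy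

theorem continuous_iteratedDeriv_apply (k : ℕ) (w : ℂ) :
    Continuous fun u : SegalBargmann => iteratedDeriv k u w :=
  let evalDeriv : SegalBargmann →ₗ[ℂ] ℂ :=
    { toFun := fun u => iteratedDeriv k u w
      map_add' := fun u v => iteratedDeriv_add u.differentiable.contDiff.contDiffAt
        v.differentiable.contDiff.contDiffAt
      map_smul' := fun c u => iteratedDeriv_const_smul u.differentiable.contDiff.contDiffAt c }
  (evalDeriv.mkContinuous _ (norm_iteratedDeriv_le k w)).continuous

theorem norm_sq_le_of_forall_norm_sq_le {f g h : SegalBargmann} {a b : ℝ}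
    (hfgh : ∀ z, ‖f z‖ ^ 2 ≤ a * ‖g z‖ ^ 2 + b * ‖h z‖ ^ 2) :
    ‖f‖ ^ 2 ≤ a * ‖g‖ ^ 2 + b * ‖h‖ ^ 2 := by
  rw [norm_sq, norm_sq, norm_sq, ← integral_const_mul, ← integral_const_mul,
    ← integral_add (g.integrable_normSq.const_mul a) (h.integrable_normSq.const_mul b)]
  refine integral_mono f.integrable_normSq
    ((g.integrable_normSq.const_mul a).add (h.integrable_normSq.const_mul b)) fun z => ?_
  calc ‖f z‖ ^ 2 * Real.exp (-‖z‖ ^ 2)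
    _ ≤ (a * ‖g z‖ ^ 2 + b * ‖h z‖ ^ 2) * Real.exp (-‖z‖ ^ 2) := by gcongr; exact hfgh z
    _ = a * (‖g z‖ ^ 2 * Real.exp (-‖z‖ ^ 2)) + b * (‖h z‖ ^ 2 * Real.exp (-‖z‖ ^ 2)) := by ring

theorem norm_apply_le_of_forall_le_norm {f h : SegalBargmann} {A R : ℝ} (hA : 0 ≤ A)
    (hfh : ∀ z, R ≤ ‖z‖ → ‖f z‖ ≤ A * ‖h z‖) {z : ℂ} (hz : ‖z‖ < R) :
    ‖f z‖ ≤ A * (Real.exp ((R + 1) ^ 2) * ‖h‖) := by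
  refine Complex.norm_le_of_forall_mem_frontier_norm_le Metric.isBounded_ball
    f.differentiable.diffContOnCl (fun w hw => ?_) (subset_closure (mem_ball_zero_iff.2 hz))
  have hwR : ‖w‖ = R := mem_sphere_zero_iff_norm.1 (Metric.frontier_ball_subset_sphere hw)
  calc ‖f w‖ ≤ A * ‖h w‖ := hfh w hwR.ge
    _ ≤ A * (Real.exp ((R + 1) ^ 2) * ‖h‖) := by
      rw [← hwR]
      gcongr
      exact h.norm_apply_le w

theorem exists_norm_le_of_forall_le_norm {A : ℝ} (hA : 0 ≤ A) (R : ℝ) :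
    ∃ C, ∀ f h : SegalBargmann, (∀ z, R ≤ ‖z‖ → ‖f z‖ ≤ A * ‖h z‖) → ‖f‖ ≤ C * ‖h‖ := by
  set M := A * Real.exp ((R + 1) ^ 2)
  refine ⟨A + M * ‖kernel 0‖, fun f h hfh => ?_⟩
  have hpoint (z : ℂ) : ‖f z‖ ^ 2 ≤ A ^ 2 * ‖h z‖ ^ 2 + (M * ‖h‖) ^ 2 * ‖kernel 0 z‖ ^ 2 := by
    have hone : kernel 0 z = 1 := by simp [kernel_apply]
    rw [hone, norm_one, one_pow, mul_one, ← mul_pow]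
    rcases le_or_gt R ‖z‖ with hz | hz
    · have := pow_le_pow_left₀ (norm_nonneg _) (hfh z hz) 2
      nlinarith [sq_nonneg (M * ‖h‖)]
    · have := pow_le_pow_left₀ (norm_nonneg _) (norm_apply_le_of_forall_le_norm hA hfh hz) 2
      rw [← mul_assoc] at this
      nlinarith [sq_nonneg (A * ‖h z‖)]
  refine le_of_sq_le_sq ?_ (by positivity)
  calc ‖f‖ ^ 2 ≤ A ^ 2 * ‖h‖ ^ 2 + (M * ‖h‖) ^ 2 * ‖kernel 0‖ ^ 2 :=
        norm_sq_le_of_forall_norm_sq_le hpoint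
    _ ≤ ((A + M * ‖kernel 0‖) * ‖h‖) ^ 2 := by
      have : 0 ≤ A * (M * ‖kernel 0‖) * ‖h‖ ^ 2 := by positivity
      linarith

end SegalBargmann

section AdjointSymbol

open SegalBargmann

variable {m : ℕ} {a : ℕ → ℂ}

/-- The polynomial `∑ conj (aₖ) Xᵏ`, multiplication by which is the adjoint of `p_m`. -/
noncomputable def adjointSymbol (m : ℕ) (a : ℕ → ℂ) : Polynomial ℂ :=
  ∑ k ∈ Finset.range (m + 1), Polynomial.C (conj (a k)) * Polynomial.X ^ k

theorem eval_adjointSymbol (m : ℕ) (a : ℕ → ℂ) (z : ℂ) :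
    (adjointSymbol m a).eval z = ∑ k ∈ Finset.range (m + 1), conj (a k) * z ^ k := by
  simp [adjointSymbol, Polynomial.eval_finsetSum]

theorem adjointSymbol_ne_zero (ha : a m ≠ 0) : adjointSymbol m a ≠ 0 := by
  intro h
  have hcoeff := congrArg (Polynomial.coeff · m) h
  simp [adjointSymbol, Polynomial.finsetSum_coeff, Polynomial.coeff_X_pow, ha] at hcoeff

theorem polyDiff_kernel (m : ℕ) (a : ℕ → ℂ) (w : ℂ) :
    polyDiff m a (kernel w) = conj ((adjointSymbol m a).eval w) • kernel w := by
  funext z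
  have hderiv (k : ℕ) : iteratedDeriv k (kernel w) z = conj w ^ k * kernel w z :=
    congrFun (iteratedDeriv_cexp_const_mul k (conj w)) z
  simp only [polyDiff, hderiv, eval_adjointSymbol, map_sum, map_mul, map_pow, Complex.conj_conj,
    Pi.smul_apply, smul_eq_mul, Finset.sum_mul, mul_assoc]

theorem mem_graph_opD_iff {u α : SegalBargmann} :
    (u, α) ∈ (opD m a).graph ↔ polyDiff m a u = α := by
  rw [LinearPMap.mem_graph_iff]
  constructor
  · rintro ⟨x, rfl, rfl⟩
    rfl
  · intro h
    have hu : polyDiff m a u ∈ segalBargmannSubmodule := h ▸ α.coe_mem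
    exact ⟨⟨u, hu⟩, rfl, toFun_injective h⟩

theorem kernel_mem_graph_opD (m : ℕ) (a : ℕ → ℂ) (w : ℂ) :
    (kernel w, conj ((adjointSymbol m a).eval w) • kernel w) ∈ (opD m a).graph :=
  mem_graph_opD_iff.2 (polyDiff_kernel m a w)

theorem dense_domain_opD (m : ℕ) (a : ℕ → ℂ) :
    Dense ((opD m a).domain : Set SegalBargmann) :=
  dense_of_kernel_mem fun w => (opD m a).mem_domain_of_mem_graph (kernel_mem_graph_opD m a w)

theorem isClosed_opD (m : ℕ) (a : ℕ → ℂ) : (opD m a).IsClosed := by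
  have hgraph : ((opD m a).graph : Set (SegalBargmann × SegalBargmann))
      = ⋂ w, {p | polyDiff m a p.1 w = p.2 w} := by
    ext ⟨u, α⟩
    rw [SetLike.mem_coe, mem_graph_opD_iff, Set.mem_iInter]
    exact funext_iff
  rw [LinearPMap.IsClosed, hgraph]
  refine isClosed_iInter fun w => isClosed_eq ?_ ?_
  · exact continuous_finsetSum _ fun k _ =>
      ((continuous_iteratedDeriv_apply k w).comp continuous_fst).const_mul (a k)
  · exact (continuous_iteratedDeriv_apply 0 w).comp continuous_snd

theorem opDstar_apply (f : (opDstar m a).domain) (z : ℂ) :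
    opDstar m a f z = (adjointSymbol m a).eval z * (f : SegalBargmann) z := by
  have hadj := inner_adjoint_eq_of_mem_graph (dense_domain_opD m a) (kernel_mem_graph_opD m a z) f
  rw [← inner_conj_symm, ← inner_conj_symm (f : SegalBargmann), inner_smul_left,
    Complex.conj_conj, inner_kernel_left, inner_kernel_left] at hadj
  have hpi : (Real.pi : ℂ) ≠ 0 := mod_cast Real.pi_ne_zero
  exact mul_left_cancel₀ hpi ((star_injective hadj).trans (mul_left_comm _ _ _))

theorem exists_antilipschitzWith_opDstar (ha : a m ≠ 0) :
    ∃ K, AntilipschitzWith K (opDstar m a) := by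
  obtain ⟨δ, hδ, R, hR⟩ := exists_pos_le_norm_eval (adjointSymbol_ne_zero ha)
  obtain ⟨C, hC⟩ := exists_norm_le_of_forall_le_norm (inv_nonneg.2 hδ.le) R
  refine ⟨C.toNNReal, AddMonoidHomClass.antilipschitz_of_bound (opDstar m a).toFun fun f => ?_⟩
  refine (hC f (opDstar m a f) fun z hz => ?_).trans ?_
  · rw [opDstar_apply, norm_mul, ← div_eq_inv_mul, le_div_iff₀' hδ]
    gcongr
    exact hR z hz
  · exact mul_le_mul_of_nonneg_right (Real.le_coe_toNNReal C) (norm_nonneg _)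

end AdjointSymbol

theorem theorem2p4 (m : ℕ) (a : ℕ → ℂ) (ha : a m ≠ 0) :
    ∃ N : SegalBargmann →L[ℂ] SegalBargmann,
      (∀ α : SegalBargmann, ∃ h : N α ∈ (boxD m a).domain, boxD m a ⟨N α, h⟩ = α) ∧
      (∀ f : (boxD m a).domain, N (boxD m a f) = f) ∧
      (kerD m a)ᗮ = imDstar m a ∧
      ∃ C : ℝ, 0 < C ∧ ∀ α : SegalBargmann,
        ∃ (h : N α ∈ (opDstar m a).domain)
          (h' : opDstar m a ⟨N α, h⟩ ∈ (opD m a).domain),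
          opD m a ⟨opDstar m a ⟨N α, h⟩, h'⟩ = α ∧
          opDstar m a ⟨N α, h⟩ ∈ (kerD m a)ᗮ ∧
          ‖opDstar m a ⟨N α, h⟩‖ ≤ C * ‖α‖ := by
  have hdense := dense_domain_opD m a
  have hclosed := isClosed_opD m a
  obtain ⟨K, hK⟩ := exists_antilipschitzWith_opDstar ha
  obtain ⟨A, hA⟩ := exists_isCanonicalSolutionOperator hdense hclosed hK
  obtain ⟨C, hC, hAC⟩ := A.bound
  have hN := hA.exists_adjoint_comp_self hdense hclosed hK
  refine ⟨A.adjoint ∘L A, fun α => ?_, fun f => ?_, orthogonal_operatorKernel hdense hclosed hK,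
    C, hC, fun α => ?_⟩
  · obtain ⟨h, h', hα, -⟩ := hN α
    exact ⟨⟨h, h'⟩, hα⟩
  · exact hA.adjoint_comp_self_eq hdense hclosed hK (f := ⟨f, f.2.1⟩)
      ((opD m a).mem_graph ⟨_, f.2.2⟩)
  · obtain ⟨h, h', hα, hNα⟩ := hN α
    have hNα : opDstar m a ⟨_, h⟩ = A α := hNα
    exact ⟨h, h', hα, hNα ▸ (hA α).2, hNα ▸ hAC α⟩
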